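/- Let $L>0$, $g(x)=\tfrac12(L^2-x^2)$, and let $\bar K<0$ satisfy $\bar K\neq -\dfrac{(2\kappa+1)^2\pi^2}{4L^3}$ for all $\kappa=0,1,2,\dots$. Consider the cascade $$\dot\vartheta(t)=\int_0^L u(y,t)\,dy,\qquad \partial_t u(x,t)=\partial_{xx}u(x,t),\qquad \partial_x u(0,t)=0,\qquad u(L,t)=U(t),$$ for $x\in(0,L)$, $t>0$, in closed loop with the controller $$U(t)=\bar K Z(t),\qquad Z(t)=\vartheta(t)+\int_0^L g(y)u(y,t)\,dy .$$ For a state $(\vartheta,u)$ put $\Omega(t)=|\vartheta(t)|^2+\int_0^L u(x,t)^2\,dx$. Then there are constants $\eta,\nu>0$, depending only on $L$ and $\bar K$, such that for every initial condition $\vartheta(0)=\vartheta_0\in\mathbb R$, $u(\cdot,0)=u_0\in L^2(0,L)$ the closed loop has a unique weak solution $(\vartheta,u)\in C([0,\infty),\mathbb R\times L^2(0,L))$, and it satisfies $$\Omega(t)\le \eta\,\Omega(0)\,e^{-\nu t}\qquad\text{for all } t\ge 0 .$$ Here $(\vartheta,u)\in C([0,\infty),\mathbb R\times L^2(0,L))$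 with the given initial values is a weak solution if $\dot\vartheta(t)=\int_0^L u(y,t)\,dy$ for all $t\ge0$, the weak derivative $\partial_x u$ belongs to $L^2(0,T;L^2(0,L))$ for every $T>0$, the trace of $u(\cdot,t)$ at $x=L$ is $\bar K Z(t)$ for almost every $t>0$, and $$\int_0^L u(x,t)\varphi(x)\,dx-\int_0^L u_0(x)\varphi(x)\,dx=-\int_0^t\!\int_0^L \partial_x u(x,s)\,\varphi'(x)\,dx\,ds$$ for all $t\ge0$ and all $\varphi\in C^1$ with $\varphi(L)=0$. Uniqueness holds even among the very weak solutions: all $(\vartheta,u)\in C([0,\infty),\mathbb R\times L^2(0,L))$ with the same initial values and the same equation for $\vartheta$ such that $$\int_0^L u(x,t)\varphi(x)\,dx-\int_0^L u_0(x)\varphi(x)\,dx=\int_0^t\Big(\int_0^L u(x,s)\varphi''(x)\,dx-\bar K Z(s)\varphi'(L)\Big)ds$$ for all $t\ge0$ and all $\varphi\in C^2$ with $\varphi'(0)=0$ and $\varphi(L)=0$. -/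

import Mathlib

open MeasureTheory Set

namespace HeatCascade

noncomputable section

/-- The Hilbert space `L²(0, L)` of real square integrable functions (modulo equality a.e.). -/
abbrev L2 (L : ℝ) : Type := Lp ℝ 2 (volume.restrict (Ioo (0 : ℝ) L))

/-- The kernel `g(x) = (L² - x²) / 2`. -/
def g (L x : ℝ) : ℝ := (1 / 2) * (L ^ 2 - x ^ 2)

/-- `Z = ϑ + ∫₀ᴸ g(y) u(y) dy`. -/
def Z (L θ : ℝ) (u : L2 L) : ℝ := θ + ∫ y in Ioo 0 L, g L y * u y

/-- `Ω = |ϑ|² + ∫₀ᴸ u(x)² dx`. -/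
def Omega (L θ : ℝ) (u : L2 L) : ℝ := |θ| ^ 2 + ∫ x in Ioo 0 L, (u x) ^ 2

/-- `f ∈ H¹(0, L)`, with weak derivative `f'` and boundary value (trace) `f(L) = a`:
`∫₀ᴸ f ψ' dx + ∫₀ᴸ f' ψ dx = a ψ(L)` for all `C¹` functions `ψ` with `ψ(0) = 0`.
(The functions `ψ` that also vanish at `L` say that `f'` is the weak derivative of `f`,
the others that the boundary value of `f` at `L` is `a`.) -/
def HasWeakDerivWithTrace (L : ℝ) (f f' : L2 L) (a : ℝ) : Prop :=
  ∀ ψ : ℝ → ℝ, ContDiff ℝ 1 ψ → ψ 0 = 0 →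
    (∫ x in Ioo 0 L, f x * deriv ψ x) + ∫ x in Ioo 0 L, f' x * ψ x = a * ψ L

/-- What both notions of solution below have in common: `(ϑ, u) ∈ C([0, ∞), ℝ × L²(0, L))`,
the initial condition, and the equation `ϑ'(t) = ∫₀ᴸ u(y, t) dy` for all `t ≥ 0`
(a one-sided derivative at `t = 0`). Only the values at times `t ≥ 0` matter. -/
structure IsTrajectory (L θ₀ : ℝ) (u₀ : L2 L) (θ : ℝ → ℝ) (u : ℝ → L2 L) : Prop where
  continuousOn_fst : ContinuousOn θ (Ici 0)
  continuousOn_snd : ContinuousOn u (Ici 0)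
  init_fst : θ 0 = θ₀
  init_snd : u 0 = u₀
  ode : ∀ t, 0 ≤ t → HasDerivWithinAt θ (∫ y in Ioo 0 L, u t y) (Ici 0) t

/-- Weak (finite energy) solutions of the closed loop `ϑ' = ∫₀ᴸ u dy`, `u_t = u_xx`,
`u_x(0, t) = 0`, `u(L, t) = K Z(t)`. The function `v` is `u_x ∈ L²(0, T; L²(0, L))`; the
Dirichlet condition at `L` holds in the sense of traces for almost every `t`; the heat equation
with the Neumann condition at `0` is tested, as usual, against all `φ` with `φ(L) = 0`. -/
structure IsWeakSolution (L K θ₀ : ℝ) (u₀ : L2 L) (θ : ℝ → ℝ) (u : ℝ → L2 L) : Prop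
    extends IsTrajectory L θ₀ u₀ θ u where
  heat : ∃ v : ℝ → L2 L,
    (∀ T : ℝ, MemLp v 2 (volume.restrict (Ioo 0 T))) ∧
    (∀ᵐ t ∂(volume.restrict (Ioi (0 : ℝ))),
      HasWeakDerivWithTrace L (u t) (v t) (K * Z L (θ t) (u t))) ∧
    ∀ φ : ℝ → ℝ, ContDiff ℝ 1 φ → φ L = 0 → ∀ t, 0 ≤ t →
      (∫ x in Ioo 0 L, u t x * φ x) - (∫ x in Ioo 0 L, u 0 x * φ x)
        = - ∫ s in (0 : ℝ)..t, ∫ x in Ioo 0 L, v s x * deriv φ x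

/-- Very weak solutions (solutions by transposition) of the same closed loop, for which nothing
beyond `(ϑ, u) ∈ C([0, ∞), ℝ × L²(0, L))` is required of `u`: two integrations by parts in `x`
against `φ` with `φ'(0) = 0` and `φ(L) = 0`. -/
structure IsVeryWeakSolution (L K θ₀ : ℝ) (u₀ : L2 L) (θ : ℝ → ℝ) (u : ℝ → L2 L) : Prop
    extends IsTrajectory L θ₀ u₀ θ u where
  heat : ∀ φ : ℝ → ℝ, ContDiff ℝ 2 φ → deriv φ 0 = 0 → φ L = 0 → ∀ t, 0 ≤ t →
    (∫ x in Ioo 0 L, u t x * φ x) - (∫ x in Ioo 0 L, u 0 x * φ x)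
      = ∫ s in (0 : ℝ)..t,
          ((∫ x in Ioo 0 L, u s x * deriv (deriv φ) x) - K * Z L (θ s) (u s) * deriv φ L)

/-- Every weak solution is a very weak one; so uniqueness of very weak solutions contains
uniqueness of weak solutions. -/
theorem IsWeakSolution.isVeryWeakSolution {L K θ₀ : ℝ} {u₀ : L2 L} {θ : ℝ → ℝ} {u : ℝ → L2 L}
    (h : IsWeakSolution L K θ₀ u₀ θ u) : IsVeryWeakSolution L K θ₀ u₀ θ u where
  toIsTrajectory := h.toIsTrajectory
  heat := by
    intro φ hφ h0 hL t ht
    obtain ⟨v, -, hv, hw⟩ := h.heat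
    have hφ' : ContDiff ℝ 1 (deriv φ) := by
      have h2 : ContDiff ℝ (1 + 1) φ := by simpa [one_add_one_eq_two] using hφ
      exact (contDiff_succ_iff_deriv.1 h2).2.2
    rw [hw φ (hφ.of_le (by norm_num)) hL t ht, ← intervalIntegral.integral_neg]
    apply intervalIntegral.integral_congr_ae
    rw [ae_restrict_iff' measurableSet_Ioi] at hv
    filter_upwards [hv] with s hs hst
    rw [uIoc_of_le ht] at hst
    have := hs hst.1 (deriv φ) hφ' h0
    linarith

end

end HeatCascade

namespace HeatCascade

open Filter Topology
open scoped RealInnerProductSpace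

/-! ### Continuous functions as elements of `L²(0, L)` -/

/-! The kernel `g` solves g'' = -1, g'(0) = 0, g(L) = 0, with g'(L) = -L. Testing the heat equation
against it cancels the integral in ϑ' and leaves Z' = L K Z (`Z_eq_exp`). So Z(t) = Z(0) e^{LKt},
and the feedback K Z is a known, decaying boundary input.

Existence: a e^{LKt} cos(√(-LK) x) solves the heat equation with the Neumann condition, and a can be
chosen to match the input at x = L provided cos(√(-LK) L) ≠ 0, which the excluded values of K
ensure. The remainder has homogeneous boundary data and is the heat flow expanded in the cosine
basis, with slowest rate `freq L 0 ^ 2`. Finally ϑ is recovered from Z by subtracting ∫ g u. Every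
piece decays exponentially, linearly in the data.

Uniqueness: two very weak solutions have the same Z, so each cosine coefficient of their difference
solves p' = -ω² p with p(0) = 0. Completeness of the cosines finishes (`IsVeryWeakSolution.unique`).
-/

theorem memLp_of_continuous (L : ℝ) {h : ℝ → ℝ} (hh : Continuous h) :
    MemLp h 2 (volume.restrict (Ioo (0 : ℝ) L)) := by
  obtain ⟨C, hC⟩ := (isCompact_Icc (a := (0 : ℝ)) (b := L)).exists_bound_of_continuousOn
    hh.continuousOn
  refine MemLp.of_bound hh.aestronglyMeasurable C ?_
  filter_upwards [ae_restrict_mem measurableSet_Ioo] with x hx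
  exact hC x (Ioo_subset_Icc_self hx)

/-- The class in `L²(0, L)` of a continuous function. -/
noncomputable def toL2 (L : ℝ) {h : ℝ → ℝ} (hh : Continuous h) : L2 L :=
  (memLp_of_continuous L hh).toLp h

theorem coeFn_toL2 (L : ℝ) {h : ℝ → ℝ} (hh : Continuous h) :
    toL2 L hh =ᵐ[volume.restrict (Ioo (0 : ℝ) L)] h :=
  (memLp_of_continuous L hh).coeFn_toLp

theorem inner_toL2 (L : ℝ) {h : ℝ → ℝ} (hh : Continuous h) (u : L2 L) :
    ⟪toL2 L hh, u⟫ = ∫ x in Ioo 0 L, u x * h x := by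
  rw [L2.inner_def]
  refine integral_congr_ae ?_
  filter_upwards [coeFn_toL2 L hh] with x hx
  simp [hx]

theorem inner_toL2_toL2 {L : ℝ} (hL : 0 ≤ L) {h k : ℝ → ℝ} (hh : Continuous h)
    (hk : Continuous k) : ⟪toL2 L hh, toL2 L hk⟫ = ∫ x in 0..L, k x * h x := by
  rw [inner_toL2, intervalIntegral.integral_of_le hL, integral_Ioc_eq_integral_Ioo]
  refine integral_congr_ae ?_
  filter_upwards [coeFn_toL2 L hk] with x hx
  simp [hx]

theorem integrable_mul_of_continuous {L : ℝ} (u : L2 L) {h : ℝ → ℝ} (hh : Continuous h) :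
    Integrable (fun x => u x * h x) (volume.restrict (Ioo (0 : ℝ) L)) :=
  (Lp.memLp u).integrable_mul (memLp_of_continuous L hh)

theorem continuous_cos_mul (ω : ℝ) : Continuous fun x : ℝ => Real.cos (ω * x) := by fun_prop

theorem continuous_sin_mul (ω : ℝ) : Continuous fun x : ℝ => Real.sin (ω * x) := by fun_prop

/-- The function `x ↦ cos (ω x)` in `L²(0, L)`. -/
noncomputable def cosL2 (L ω : ℝ) : L2 L := toL2 L (continuous_cos_mul ω)

/-- The function `x ↦ sin (ω x)` in `L²(0, L)`. -/
noncomputable def sinL2 (L ω : ℝ) : L2 L := toL2 L (continuous_sin_mul ω)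

theorem hasDerivAt_cos_mul (ω x : ℝ) :
    HasDerivAt (fun x : ℝ => Real.cos (ω * x)) (-ω * Real.sin (ω * x)) x := by
  have := (Real.hasDerivAt_cos (ω * x)).comp x ((hasDerivAt_id x).const_mul ω)
  simpa [Function.comp_def, mul_comm] using this

theorem hasDerivAt_sin_mul (ω x : ℝ) :
    HasDerivAt (fun x : ℝ => Real.sin (ω * x)) (ω * Real.cos (ω * x)) x := by
  have := (Real.hasDerivAt_sin (ω * x)).comp x ((hasDerivAt_id x).const_mul ω)
  simpa [Function.comp_def, mul_comm] using this

/-- Integration by parts without boundary terms: the sine vanishes at 0 and φ at L. -/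
theorem inner_deriv_sinL2 {L : ℝ} (hL : 0 ≤ L) (ω : ℝ) {φ : ℝ → ℝ} (hφ : ContDiff ℝ 1 φ)
    (hφL : φ L = 0) :
    ⟪toL2 L (hφ.continuous_deriv le_rfl), sinL2 L ω⟫
      = -ω * ⟪toL2 L hφ.continuous, cosL2 L ω⟫ := by
  have hd : Continuous (deriv φ) := hφ.continuous_deriv le_rfl
  rw [sinL2, cosL2, inner_toL2_toL2 hL, inner_toL2_toL2 hL,
    intervalIntegral.integral_mul_deriv_eq_deriv_mul (fun x _ => hasDerivAt_sin_mul ω x)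
      (fun x _ => (hφ.differentiable one_ne_zero x).hasDerivAt)
      (Continuous.intervalIntegrable (by fun_prop) _ _) (hd.intervalIntegrable _ _),
    ← intervalIntegral.integral_const_mul]
  simp [hφL, mul_assoc]

/-- The surviving boundary term at L is the trace: zero at the frequencies `freq L k`, the boundary
input at `driveFreq`. -/
theorem inner_deriv_cosL2 {L : ℝ} (hL : 0 ≤ L) (ω : ℝ) {ψ : ℝ → ℝ} (hψ : ContDiff ℝ 1 ψ)
    (hψ0 : ψ 0 = 0) :
    ⟪toL2 L (hψ.continuous_deriv le_rfl), cosL2 L ω⟫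
      = Real.cos (ω * L) * ψ L + ω * ⟪toL2 L hψ.continuous, sinL2 L ω⟫ := by
  have hd : Continuous (deriv ψ) := hψ.continuous_deriv le_rfl
  rw [sinL2, cosL2, inner_toL2_toL2 hL, inner_toL2_toL2 hL,
    intervalIntegral.integral_mul_deriv_eq_deriv_mul (fun x _ => hasDerivAt_cos_mul ω x)
      (fun x _ => (hψ.differentiable one_ne_zero x).hasDerivAt)
      (Continuous.intervalIntegrable (by fun_prop) _ _) (hd.intervalIntegrable _ _),
    ← intervalIntegral.integral_const_mul]
  simp [hψ0, mul_assoc]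

/-! ### The eigenfunctions of the Laplacian with Neumann condition at `0`, Dirichlet at `L` -/

/-- The frequencies `(k + 1/2) π / L`. -/
noncomputable def freq (L : ℝ) (k : ℕ) : ℝ := ((k : ℝ) + 1 / 2) * Real.pi / L

theorem freq_pos {L : ℝ} (hL : 0 < L) (k : ℕ) : 0 < freq L k := by
  unfold freq; positivity

theorem freq_mono {L : ℝ} (hL : 0 < L) (k : ℕ) : freq L 0 ≤ freq L k := by
  unfold freq
  gcongr
  simp

theorem cos_freq_mul {L : ℝ} (hL : 0 < L) (k : ℕ) : Real.cos (freq L k * L) = 0 := by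
  rw [Real.cos_eq_zero_iff]
  refine ⟨k, ?_⟩
  unfold freq
  field_simp
  push_cast
  ring

/-- The normalized cosine eigenfunctions. -/
noncomputable def cosMode (L : ℝ) (k : ℕ) : L2 L := √(2 / L) • cosL2 L (freq L k)

/-- The normalized derivatives of the cosine eigenfunctions. -/
noncomputable def sinMode (L : ℝ) (k : ℕ) : L2 L := √(2 / L) • sinL2 L (freq L k)

theorem integral_cos_int_mul {L : ℝ} (hL : 0 < L) (m : ℤ) :
    ∫ x in 0..L, Real.cos (m * Real.pi / L * x) = if m = 0 then L else 0 := by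
  split_ifs with h
  · simp [h]
  · have hm : (m : ℝ) * Real.pi / L ≠ 0 := by
      have : (m : ℝ) ≠ 0 := by exact_mod_cast h
      positivity
    rw [intervalIntegral.integral_comp_mul_left (fun x => Real.cos x) hm, integral_cos]
    have : (m : ℝ) * Real.pi / L * L = m * Real.pi := by field_simp
    simp [this, Real.sin_int_mul_pi]

theorem inner_cosL2_freq {L : ℝ} (hL : 0 < L) (j k : ℕ) :
    ⟪cosL2 L (freq L j), cosL2 L (freq L k)⟫ = if j = k then L / 2 else 0 := by
  have h1 := integral_cos_int_mul hL ((j : ℤ) - k)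
  have h2 := integral_cos_int_mul hL ((j : ℤ) + k + 1)
  rw [if_neg (by omega)] at h2
  have h3 : ((j : ℤ) - k = 0) ↔ j = k := by omega
  simp only [h3] at h1
  rw [cosL2, cosL2, inner_toL2_toL2 hL.le]
  have : ∀ x : ℝ, Real.cos (freq L k * x) * Real.cos (freq L j * x)
      = 1 / 2 * (Real.cos (((j : ℤ) - k : ℤ) * Real.pi / L * x)
        + Real.cos (((j : ℤ) + k + 1 : ℤ) * Real.pi / L * x)) := by
    intro x
    have e1 : (((j : ℤ) - k : ℤ) : ℝ) * Real.pi / L * x = freq L j * x - freq L k * x := by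
      unfold freq; push_cast; ring
    have e2 : (((j : ℤ) + k + 1 : ℤ) : ℝ) * Real.pi / L * x = freq L j * x + freq L k * x := by
      unfold freq; push_cast; ring
    rw [e1, e2, Real.cos_sub, Real.cos_add]
    ring
  simp only [this]
  rw [intervalIntegral.integral_const_mul, intervalIntegral.integral_add
    (Continuous.intervalIntegrable (by fun_prop) _ _)
    (Continuous.intervalIntegrable (by fun_prop) _ _), h1, h2]
  split_ifs <;> ring

theorem inner_sinL2_freq {L : ℝ} (hL : 0 < L) (j k : ℕ) :
    ⟪sinL2 L (freq L j), sinL2 L (freq L k)⟫ = if j = k then L / 2 else 0 := by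
  have h1 := integral_cos_int_mul hL ((j : ℤ) - k)
  have h2 := integral_cos_int_mul hL ((j : ℤ) + k + 1)
  rw [if_neg (by omega)] at h2
  have h3 : ((j : ℤ) - k = 0) ↔ j = k := by omega
  simp only [h3] at h1
  rw [sinL2, sinL2, inner_toL2_toL2 hL.le]
  have : ∀ x : ℝ, Real.sin (freq L k * x) * Real.sin (freq L j * x)
      = 1 / 2 * (Real.cos (((j : ℤ) - k : ℤ) * Real.pi / L * x)
        - Real.cos (((j : ℤ) + k + 1 : ℤ) * Real.pi / L * x)) := by
    intro x
    have e1 : (((j : ℤ) - k : ℤ) : ℝ) * Real.pi / L * x = freq L j * x - freq L k * x := by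
      unfold freq; push_cast; ring
    have e2 : (((j : ℤ) + k + 1 : ℤ) : ℝ) * Real.pi / L * x = freq L j * x + freq L k * x := by
      unfold freq; push_cast; ring
    rw [e1, e2, Real.cos_sub, Real.cos_add]
    ring
  simp only [this]
  rw [intervalIntegral.integral_const_mul, intervalIntegral.integral_sub
    (Continuous.intervalIntegrable (by fun_prop) _ _)
    (Continuous.intervalIntegrable (by fun_prop) _ _), h1, h2]
  split_ifs <;> ring

theorem orthonormal_cosMode {L : ℝ} (hL : 0 < L) : Orthonormal ℝ (cosMode L) := by
  rw [orthonormal_iff_ite]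
  intro i j
  rw [cosMode, cosMode, inner_smul_left, inner_smul_right, inner_cosL2_freq hL, ← mul_assoc]
  simp only [conj_trivial]
  rw [Real.mul_self_sqrt (by positivity)]
  split_ifs
  · field_simp
  · simp

theorem orthonormal_sinMode {L : ℝ} (hL : 0 < L) : Orthonormal ℝ (sinMode L) := by
  rw [orthonormal_iff_ite]
  intro i j
  rw [sinMode, sinMode, inner_smul_left, inner_smul_right, inner_sinL2_freq hL, ← mul_assoc]
  simp only [conj_trivial]
  rw [Real.mul_self_sqrt (by positivity)]
  split_ifs
  · field_simp
  · simp

/-! ### Completeness of the cosine eigenfunctions -/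

/-- By the product-to-sum formula, multiplying a mode by cos(πx/L) averages its two neighbours, so
the span of the modes is stable under polynomials in cos(πx/L). -/
theorem integral_cosMode_mul_cos_pow_eq_zero {L : ℝ} (u : L2 L)
    (hu : ∀ k : ℕ, ∫ x in Ioo 0 L, u x * Real.cos (freq L k * x) = 0) (n : ℕ) :
    ∀ k : ℕ, ∫ x in Ioo 0 L,
      u x * (Real.cos (freq L k * x) * Real.cos (Real.pi / L * x) ^ n) = 0 := by
  induction n with
  | zero => simpa using hu
  | succ n ih =>
    have key : ∀ j l k : ℕ, (∀ x, Real.cos (freq L k * x) * Real.cos (Real.pi / L * x)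
        = 1 / 2 * (Real.cos (freq L j * x) + Real.cos (freq L l * x))) →
        ∫ x in Ioo 0 L,
          u x * (Real.cos (freq L k * x) * Real.cos (Real.pi / L * x) ^ (n + 1)) = 0 := by
      intro j l k h
      have e : ∀ x, u x * (Real.cos (freq L k * x) * Real.cos (Real.pi / L * x) ^ (n + 1))
          = 1 / 2 * (u x * (Real.cos (freq L j * x) * Real.cos (Real.pi / L * x) ^ n)
            + u x * (Real.cos (freq L l * x) * Real.cos (Real.pi / L * x) ^ n)) := by
        intro x
        linear_combination (u x * Real.cos (Real.pi / L * x) ^ n) * h x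
      simp only [e]
      rw [integral_const_mul, integral_add (integrable_mul_of_continuous u (by fun_prop))
        (integrable_mul_of_continuous u (by fun_prop)), ih, ih]
      simp
    intro k
    rcases k with _ | k
    -- The lower neighbour of mode 0 has frequency -`freq L 0`; the cosine being even, it is mode 0
    -- again.
    · refine key 1 0 0 fun x => ?_
      have e1 : freq L 1 * x = freq L 0 * x + Real.pi / L * x := by
        unfold freq; push_cast; ring
      have e2 : Real.pi / L * x = freq L 0 * x + freq L 0 * x := by
        unfold freq; push_cast; ring
      rw [e1, e2]
      simp only [Real.cos_add, Real.sin_add]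
      linear_combination (1 / 2 * Real.cos (freq L 0 * x)) * Real.sin_sq_add_cos_sq (freq L 0 * x)
    · refine key (k + 2) k (k + 1) fun x => ?_
      have e1 : freq L (k + 2) * x = freq L (k + 1) * x + Real.pi / L * x := by
        unfold freq; push_cast; ring
      have e2 : freq L k * x = freq L (k + 1) * x - Real.pi / L * x := by
        unfold freq; push_cast; ring
      rw [e1, e2, Real.cos_add, Real.cos_sub]
      ring

theorem integral_mul_cos_mul_eq_zero {L : ℝ} (hL : 0 < L) (u : L2 L)
    (hu : ∀ k : ℕ, ∫ x in Ioo 0 L, u x * Real.cos (freq L k * x) = 0) {q : ℝ → ℝ}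
    (hq : Continuous q) :
    ∫ x in Ioo 0 L, u x * (Real.cos (freq L 0 * x) * q x) = 0 := by
  set h : ℝ → ℝ := fun x => Real.cos (freq L 0 * x) with hh
  have hhc : Continuous h := by fun_prop
  have hpoly : ∀ p : Polynomial ℝ,
      ∫ x in Ioo 0 L, u x * (h x * p.eval (Real.cos (Real.pi / L * x))) = 0 := by
    intro p
    induction p using Polynomial.induction_on' with
    | add p q hp hq =>
      simp only [Polynomial.eval_add, mul_add]
      rw [integral_add (integrable_mul_of_continuous u (by fun_prop))
        (integrable_mul_of_continuous u (by fun_prop)), hp, hq, add_zero]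
    | monomial n a =>
      have := integral_cosMode_mul_cos_pow_eq_zero u hu n 0
      have e : ∀ x, u x * (h x * (Polynomial.monomial n a).eval (Real.cos (Real.pi / L * x)))
          = a * (u x * (Real.cos (freq L 0 * x) * Real.cos (Real.pi / L * x) ^ n)) := by
        intro x
        rw [Polynomial.eval_monomial]
        ring
      simp only [e]
      rw [integral_const_mul, this, mul_zero]
  have hint := (integrable_mul_of_continuous u hhc).norm
  set M := ∫ x in Ioo 0 L, ‖u x * h x‖ with hM
  have hM0 : 0 ≤ M := integral_nonneg fun _ => norm_nonneg _
  refine abs_eq_zero.1 (le_antisymm (le_of_forall_pos_le_add fun ε hε => ?_) (abs_nonneg _))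
  -- On [0, L] the substitution z = cos(πx/L) is inverted by x = (L/π) arccos z, so Weierstrass
  -- approximation in z reaches every continuous q. The +1 in `M + 1` avoids division by zero.
  have hr : ContinuousOn (fun z => q (L / Real.pi * Real.arccos z)) (Icc (-1) 1) :=
    (hq.comp (continuous_const.mul Real.continuous_arccos)).continuousOn
  obtain ⟨p, hp⟩ := exists_polynomial_near_of_continuousOn _ _ _ hr (ε / (M + 1)) (by positivity)
  have e : ∫ x in Ioo 0 L, u x * (h x * q x)
      = -∫ x in Ioo 0 L, u x * h x * (p.eval (Real.cos (Real.pi / L * x)) - q x) := by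
    have e' : ∀ x, u x * h x * (p.eval (Real.cos (Real.pi / L * x)) - q x)
        = u x * (h x * p.eval (Real.cos (Real.pi / L * x))) - u x * (h x * q x) := by
      intro x; ring
    simp only [e']
    rw [integral_sub (integrable_mul_of_continuous u (by fun_prop))
      (integrable_mul_of_continuous u (by fun_prop)), hpoly]
    ring
  rw [e, abs_neg, zero_add]
  calc |∫ x in Ioo 0 L, u x * h x * (p.eval (Real.cos (Real.pi / L * x)) - q x)|
      ≤ ∫ x in Ioo 0 L, ‖u x * h x‖ * (ε / (M + 1)) := by
        rw [← Real.norm_eq_abs]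
        refine norm_integral_le_of_norm_le (hint.mul_const _) ?_
        filter_upwards [ae_restrict_mem measurableSet_Ioo] with x hx
        rw [norm_mul]
        gcongr
        have := hp (Real.cos (Real.pi / L * x)) ⟨Real.neg_one_le_cos _, Real.cos_le_one _⟩
        rw [Real.arccos_cos (by have := hx.1; positivity)
          (by rw [div_mul_eq_mul_div, div_le_iff₀ hL]; gcongr; exact hx.2.le)] at this
        rw [show L / Real.pi * (Real.pi / L * x) = x by field_simp] at this
        exact this.le
    _ = M * (ε / (M + 1)) := by rw [integral_mul_const]
    _ ≤ ε := by
        rw [mul_div_assoc', div_le_iff₀ (by positivity)]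
        nlinarith

theorem eq_zero_of_forall_integral_cos_eq_zero {L : ℝ} (hL : 0 < L) (u : L2 L)
    (hu : ∀ k : ℕ, ∫ x in Ioo 0 L, u x * Real.cos (freq L k * x) = 0) : u = 0 := by
  have h0 : ∀ᵐ x ∂(volume.restrict (Ioo (0 : ℝ) L)), u x * Real.cos (freq L 0 * x) = 0 := by
    refine ae_eq_zero_of_integral_contDiff_smul_eq_zero
      (integrable_mul_of_continuous u (by fun_prop)).locallyIntegrable fun q hq _ => ?_
    refine (integral_congr_ae (ae_of_all _ fun x => ?_)).trans
      (integral_mul_cos_mul_eq_zero hL u hu hq.continuous)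
    simp only [smul_eq_mul]
    ring
  rw [Lp.eq_zero_iff_ae_eq_zero]
  filter_upwards [h0, ae_restrict_mem measurableSet_Ioo] with x hx hxL
  -- The lowest mode can be divided out, as `freq L 0 * x` lies strictly between 0 and π/2.
  have : 0 < Real.cos (freq L 0 * x) := by
    have hpi := Real.pi_pos
    have hf : freq L 0 * x = x / L * (Real.pi / 2) := by unfold freq; push_cast; ring
    have h1 : x / L < 1 := by rw [div_lt_one hL]; exact hxL.2
    have h2 : 0 < x / L := div_pos hxL.1 hL
    refine Real.cos_pos_of_mem_Ioo ⟨?_, ?_⟩ <;> rw [hf] <;> nlinarith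
  simpa [this.ne'] using hx

theorem inner_cosMode (L : ℝ) (k : ℕ) (u : L2 L) :
    ⟪cosMode L k, u⟫ = √(2 / L) * ∫ x in Ioo 0 L, u x * Real.cos (freq L k * x) := by
  rw [cosMode, inner_smul_left, cosL2, inner_toL2]
  simp

theorem eq_zero_of_forall_inner_cosMode {L : ℝ} (hL : 0 < L) (u : L2 L)
    (hu : ∀ k : ℕ, ⟪cosMode L k, u⟫ = 0) : u = 0 := by
  refine eq_zero_of_forall_integral_cos_eq_zero hL u fun k => ?_
  have h := hu k
  rw [inner_cosMode] at h
  have : √(2 / L) ≠ 0 := by positivity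
  exact (mul_eq_zero.1 h).resolve_left this

/-- The Hilbert basis of cosine eigenfunctions. -/
noncomputable def cosBasis {L : ℝ} (hL : 0 < L) : HilbertBasis ℕ ℝ (L2 L) :=
  HilbertBasis.mkOfOrthogonalEqBot (orthonormal_cosMode hL) <| by
    rw [Submodule.eq_bot_iff]
    intro u hu
    exact eq_zero_of_forall_inner_cosMode hL u fun k =>
      Submodule.inner_right_of_mem_orthogonal (Submodule.subset_span (mem_range_self k)) hu

theorem cosBasis_apply {L : ℝ} (hL : 0 < L) (k : ℕ) : cosBasis hL k = cosMode L k := by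
  rw [cosBasis, HilbertBasis.coe_mkOfOrthogonalEqBot]

/-! ### Series along orthonormal sequences -/

section Orthonormal

variable {E : Type*} [NormedAddCommGroup E] [InnerProductSpace ℝ E] [CompleteSpace E]

theorem summable_smul_of_orthonormal {e : ℕ → E} (he : Orthonormal ℝ e) {a : ℕ → ℝ}
    (ha : Summable fun k => a k ^ 2) : Summable fun k => a k • e k := by
  have := (he.orthogonalFamily.summable_iff_norm_sq_summable a).2 (by simpa using ha)
  simpa using this

theorem inner_tsum_smul_of_orthonormal {e : ℕ → E} (he : Orthonormal ℝ e) {a : ℕ → ℝ}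
    (ha : Summable fun k => a k ^ 2) (k : ℕ) : ⟪e k, ∑' j, a j • e j⟫ = a k := by
  have h := (summable_smul_of_orthonormal he ha).hasSum.mapL (innerSL ℝ (e k))
  have h' := hasSum_ite_eq k (a k)
  refine h.unique (h'.congr_fun fun j => ?_)
  simp only [innerSL_apply_apply, inner_smul_right, orthonormal_iff_ite.1 he]
  by_cases hjk : j = k
  · simp [hjk]
  · simp [hjk, Ne.symm hjk]

theorem hasSum_sq_of_orthonormal {e : ℕ → E} (he : Orthonormal ℝ e) {a : ℕ → ℝ}
    (ha : Summable fun k => a k ^ 2) :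
    HasSum (fun k => a k ^ 2) (‖∑' j, a j • e j‖ ^ 2) := by
  have h := (summable_smul_of_orthonormal he ha).hasSum.mapL (innerSL ℝ (∑' j, a j • e j))
  rw [innerSL_apply_apply, real_inner_self_eq_norm_sq] at h
  refine h.congr_fun fun k => ?_
  rw [innerSL_apply_apply, inner_smul_right, real_inner_comm,
    inner_tsum_smul_of_orthonormal he ha, sq]

end Orthonormal

/-! ### The heat semigroup with Neumann condition at `0`, Dirichlet condition at `L` -/

theorem hasSum_inner_cosMode_sq {L : ℝ} (hL : 0 < L) (f : L2 L) :
    HasSum (fun k => ⟪cosMode L k, f⟫ ^ 2) (‖f‖ ^ 2) := by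
  have h := (cosBasis hL).hasSum_inner_mul_inner f f
  rw [real_inner_self_eq_norm_sq] at h
  refine h.congr_fun fun k => ?_
  rw [real_inner_comm (cosBasis hL k) f, cosBasis_apply, sq]

theorem ext_inner_cosMode {L : ℝ} (hL : 0 < L) {f g : L2 L}
    (h : ∀ k, ⟪cosMode L k, f⟫ = ⟪cosMode L k, g⟫) : f = g := by
  rw [← sub_eq_zero]
  refine eq_zero_of_forall_inner_cosMode hL _ fun k => ?_
  rw [inner_sub_right, h, sub_self]

/-- The factor `exp (-ω² t)` by which the mode of frequency `ω` decays. -/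
noncomputable def decay (L : ℝ) (k : ℕ) (t : ℝ) : ℝ := Real.exp (-(freq L k ^ 2) * t)

theorem decay_pos (L : ℝ) (k : ℕ) (t : ℝ) : 0 < decay L k t := Real.exp_pos _

@[simp] theorem decay_zero (L : ℝ) (k : ℕ) : decay L k 0 = 1 := by simp [decay]

theorem continuous_decay (L : ℝ) (k : ℕ) : Continuous (decay L k) := by
  unfold decay; fun_prop

theorem decay_le {L : ℝ} (hL : 0 < L) (k : ℕ) {t : ℝ} (ht : 0 ≤ t) :
    decay L k t ≤ Real.exp (-(freq L 0 ^ 2) * t) := by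
  have h0 := freq_pos hL 0
  have h1 := freq_mono hL k
  unfold decay
  gcongr

/-- This is s e^{-s} ≤ 1 at s = 2tω²: for t > 0 the decay absorbs the factor ω of a space
derivative, uniformly in the mode. -/
theorem freq_mul_decay_sq_le {L : ℝ} (k : ℕ) {t : ℝ} (ht : 0 < t) :
    (freq L k * decay L k t) ^ 2 ≤ 1 / (2 * t) := by
  have h : (freq L k * decay L k t) ^ 2
      = freq L k ^ 2 * Real.exp (-(2 * t * freq L k ^ 2)) := by
    rw [mul_pow, decay, ← Real.exp_nat_mul]
    congr 2
    push_cast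
    ring
  rw [h, Real.exp_neg, ← div_eq_mul_inv, div_le_div_iff₀ (Real.exp_pos _) (by positivity)]
  have := Real.add_one_le_exp (2 * t * freq L k ^ 2)
  nlinarith

/-- The solution at time `t` of the heat equation with Neumann condition at `0`, Dirichlet
condition at `L` and initial value `f`. -/
noncomputable def heat (L : ℝ) (f : L2 L) (t : ℝ) : L2 L :=
  ∑' k, (decay L k t * ⟪cosMode L k, f⟫) • cosMode L k

/-- The space derivative of `heat L f t`. -/
noncomputable def heatDeriv (L : ℝ) (f : L2 L) (t : ℝ) : L2 L :=
  ∑' k, (-(freq L k * decay L k t * ⟪cosMode L k, f⟫)) • sinMode L k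

theorem summable_decay_mul_sq {L : ℝ} (hL : 0 < L) (f : L2 L) {t : ℝ} (ht : 0 ≤ t) :
    Summable fun k => (decay L k t * ⟪cosMode L k, f⟫) ^ 2 := by
  refine Summable.of_nonneg_of_le (fun k => sq_nonneg _) (fun k => ?_)
    (hasSum_inner_cosMode_sq hL f).summable
  have h1 : decay L k t ≤ 1 := by
    refine (decay_le hL k ht).trans (Real.exp_le_one_iff.2 ?_)
    have := freq_pos hL 0
    rw [neg_mul]
    exact neg_nonpos.2 (by positivity)
  have h2 := (decay_pos L k t).le
  rw [mul_pow]
  exact mul_le_of_le_one_left (sq_nonneg _) (pow_le_one₀ h2 h1)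

theorem summable_freq_mul_decay_mul_sq {L : ℝ} (hL : 0 < L) (f : L2 L) {t : ℝ} (ht : 0 < t) :
    Summable fun k => (-(freq L k * decay L k t * ⟪cosMode L k, f⟫)) ^ 2 := by
  refine Summable.of_nonneg_of_le (fun k => sq_nonneg _) (fun k => ?_)
    ((hasSum_inner_cosMode_sq hL f).summable.mul_left (1 / (2 * t)))
  rw [neg_sq, mul_pow]
  gcongr
  exact freq_mul_decay_sq_le k ht

theorem inner_cosMode_heat {L : ℝ} (hL : 0 < L) (f : L2 L) {t : ℝ} (ht : 0 ≤ t) (k : ℕ) :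
    ⟪cosMode L k, heat L f t⟫ = decay L k t * ⟪cosMode L k, f⟫ :=
  inner_tsum_smul_of_orthonormal (orthonormal_cosMode hL) (summable_decay_mul_sq hL f ht) k

theorem heat_zero {L : ℝ} (hL : 0 < L) (f : L2 L) : heat L f 0 = f :=
  ext_inner_cosMode hL fun k => by simp [inner_cosMode_heat hL f le_rfl]

theorem heat_add {L : ℝ} (hL : 0 < L) (f g : L2 L) {t : ℝ} (ht : 0 ≤ t) :
    heat L (f + g) t = heat L f t + heat L g t :=
  ext_inner_cosMode hL fun k => by
    simp only [inner_add_right, inner_cosMode_heat hL _ ht, mul_add]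

theorem heat_smul {L : ℝ} (hL : 0 < L) (c : ℝ) (f : L2 L) {t : ℝ} (ht : 0 ≤ t) :
    heat L (c • f) t = c • heat L f t :=
  ext_inner_cosMode hL fun k => by
    simp only [inner_smul_right, inner_cosMode_heat hL _ ht]; ring

theorem heat_sub {L : ℝ} (hL : 0 < L) (f g : L2 L) {t : ℝ} (ht : 0 ≤ t) :
    heat L (f - g) t = heat L f t - heat L g t :=
  ext_inner_cosMode hL fun k => by
    simp only [inner_sub_right, inner_cosMode_heat hL _ ht, mul_sub]

theorem heat_cosMode {L : ℝ} (hL : 0 < L) (j : ℕ) {t : ℝ} (ht : 0 ≤ t) :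
    heat L (cosMode L j) t = decay L j t • cosMode L j :=
  ext_inner_cosMode hL fun k => by
    rw [inner_cosMode_heat hL _ ht, inner_smul_right,
      orthonormal_iff_ite.1 (orthonormal_cosMode hL)]
    by_cases h : k = j <;> simp [h]

theorem norm_heat_le {L : ℝ} (hL : 0 < L) (f : L2 L) {t : ℝ} (ht : 0 ≤ t) :
    ‖heat L f t‖ ≤ Real.exp (-(freq L 0 ^ 2) * t) * ‖f‖ := by
  refine abs_le_of_sq_le_sq' ?_ (by positivity) |>.2
  rw [mul_pow]
  refine hasSum_le (fun k => ?_)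
    (hasSum_sq_of_orthonormal (orthonormal_cosMode hL) (summable_decay_mul_sq hL f ht))
    ((hasSum_inner_cosMode_sq hL f).mul_left _)
  rw [mul_pow]
  have := decay_le hL k ht
  have := (decay_pos L k t).le
  gcongr

/-- On the span of the modes the flow is a finite sum of exponentials. The span is dense and the
flow is a contraction, so a general trajectory is a uniform limit of these. -/
theorem continuousOn_heat {L : ℝ} (hL : 0 < L) (f : L2 L) : ContinuousOn (heat L f) (Ici 0) := by
  have hspan : ∀ g ∈ Submodule.span ℝ (range (cosMode L)), ContinuousOn (heat L g) (Ici 0) := by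
    intro g hg
    induction hg using Submodule.span_induction with
    | mem x hx =>
      obtain ⟨j, rfl⟩ := hx
      exact ((continuous_decay L j).smul continuous_const).continuousOn.congr
        fun t ht => heat_cosMode hL j ht
    | zero =>
      refine (continuousOn_const (c := (0 : L2 L))).congr fun t ht => ?_
      simpa using heat_smul hL 0 (0 : L2 L) ht
    | add x y _ _ hx hy => exact (hx.add hy).congr fun t ht => heat_add hL x y ht
    | smul c x _ hx => exact (hx.const_smul c).congr fun t ht => heat_smul hL c x ht
  have hdense : f ∈ closure (Submodule.span ℝ (range (cosMode L)) : Set (L2 L)) := by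
    have h := (cosBasis hL).dense_span
    have hr : range (cosBasis hL) = range (cosMode L) := by
      congr 1; funext k; exact cosBasis_apply hL k
    rw [hr] at h
    have : f ∈ (Submodule.span ℝ (range (cosMode L))).topologicalClosure := by
      rw [h]; trivial
    exact this
  refine continuousOn_of_uniform_approx_of_continuousOn fun U hU => ?_
  obtain ⟨ε, hε, hεU⟩ := Metric.mem_uniformity_dist.1 hU
  obtain ⟨g, hg, hfg⟩ := Metric.mem_closure_iff.1 hdense ε hε
  refine ⟨heat L g, hspan g hg, fun t ht => hεU ?_⟩
  rw [dist_eq_norm, ← heat_sub hL _ _ ht]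
  refine lt_of_le_of_lt ((norm_heat_le hL _ ht).trans ?_) (by rwa [dist_eq_norm] at hfg)
  refine mul_le_of_le_one_left (norm_nonneg _) (Real.exp_le_one_iff.2 ?_)
  have h0 := freq_pos hL 0
  have h1 : (0 : ℝ) ≤ t := ht
  rw [neg_mul]
  exact neg_nonpos.2 (by positivity)

theorem hasSum_heat {L : ℝ} (hL : 0 < L) (f : L2 L) {t : ℝ} (ht : 0 ≤ t) :
    HasSum (fun k => (decay L k t * ⟪cosMode L k, f⟫) • cosMode L k) (heat L f t) :=
  (summable_smul_of_orthonormal (orthonormal_cosMode hL) (summable_decay_mul_sq hL f ht)).hasSum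

theorem hasSum_heatDeriv {L : ℝ} (hL : 0 < L) (f : L2 L) {t : ℝ} (ht : 0 < t) :
    HasSum (fun k => (-(freq L k * decay L k t * ⟪cosMode L k, f⟫)) • sinMode L k)
      (heatDeriv L f t) :=
  (summable_smul_of_orthonormal (orthonormal_sinMode hL)
    (summable_freq_mul_decay_mul_sq hL f ht)).hasSum

theorem hasSum_sq_heatDeriv {L : ℝ} (hL : 0 < L) (f : L2 L) {t : ℝ} (ht : 0 < t) :
    HasSum (fun k => (freq L k * decay L k t * ⟪cosMode L k, f⟫) ^ 2) (‖heatDeriv L f t‖ ^ 2) := by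
  simpa only [neg_sq, heatDeriv] using hasSum_sq_of_orthonormal (orthonormal_sinMode hL)
    (summable_freq_mul_decay_mul_sq hL f ht)

theorem hasWeakDerivWithTrace_heat {L : ℝ} (hL : 0 < L) (f : L2 L) {t : ℝ} (ht : 0 < t) :
    HasWeakDerivWithTrace L (heat L f t) (heatDeriv L f t) 0 := by
  intro ψ hψ hψ0
  rw [← inner_toL2 L (hψ.continuous_deriv le_rfl), ← inner_toL2 L hψ.continuous, zero_mul]
  have h1 := (hasSum_heat hL f ht.le).mapL (innerSL ℝ (toL2 L (hψ.continuous_deriv le_rfl)))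
  have h2 := (hasSum_heatDeriv hL f ht).mapL (innerSL ℝ (toL2 L hψ.continuous))
  refine (h1.add h2).unique (hasSum_zero.congr_fun fun k => ?_)
  simp only [innerSL_apply_apply, inner_smul_right, cosMode, sinMode,
    inner_deriv_cosL2 hL.le _ hψ hψ0, cos_freq_mul hL]
  ring

theorem integral_decay {L : ℝ} (k : ℕ) (t : ℝ) :
    freq L k ^ 2 * ∫ s in 0..t, decay L k s = 1 - decay L k t := by
  have h : ∀ s ∈ uIcc 0 t, HasDerivAt (fun s => -decay L k s) (freq L k ^ 2 * decay L k s) s := by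
    intro s _
    have := ((hasDerivAt_id s).const_mul (-(freq L k ^ 2))).exp.neg
    simpa [decay, mul_comm, Pi.neg_def] using this
  rw [← intervalIntegral.integral_const_mul, intervalIntegral.integral_eq_sub_of_hasDerivAt h
    ((continuous_const.mul (continuous_decay L k)).intervalIntegrable _ _)]
  simp
  ring

/-- The identity holds mode by mode, and the point is to exchange sum and time integral. Integrating
ω² e^{-ω²s} over [0, t] gives at most 1, so the coefficients `c k` dominate. -/
theorem heat_weak_identity {L : ℝ} (hL : 0 < L) (f : L2 L) {φ : ℝ → ℝ} (hφ : ContDiff ℝ 1 φ)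
    (hφL : φ L = 0) {t : ℝ} (ht : 0 ≤ t) :
    ⟪toL2 L hφ.continuous, heat L f t⟫ - ⟪toL2 L hφ.continuous, f⟫
      = -∫ s in 0..t, ⟪toL2 L (hφ.continuous_deriv le_rfl), heatDeriv L f s⟫ := by
  set c : ℕ → ℝ := fun k => ⟪cosMode L k, f⟫ * ⟪toL2 L hφ.continuous, cosMode L k⟫ with hc
  -- Products of Fourier coefficients of two L² functions: |ab| ≤ a² + b², then Parseval.
  have hcs : Summable fun k => |c k| := by
    refine Summable.of_nonneg_of_le (fun k => abs_nonneg _) (fun k => ?_)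
      ((hasSum_inner_cosMode_sq hL f).summable.add
        (hasSum_inner_cosMode_sq hL (toL2 L hφ.continuous)).summable)
    rw [hc]
    simp only
    rw [real_inner_comm (cosMode L k) (toL2 L hφ.continuous), abs_le]
    constructor <;> nlinarith [sq_nonneg (⟪cosMode L k, f⟫ + ⟪cosMode L k, toL2 L hφ.continuous⟫),
      sq_nonneg (⟪cosMode L k, f⟫ - ⟪cosMode L k, toL2 L hφ.continuous⟫)]
  set F : ℕ → ℝ → ℝ := fun k s => freq L k ^ 2 * decay L k s * c k with hF
  have hFc : ∀ k, Continuous (F k) := fun k =>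
    (continuous_const.mul (continuous_decay L k)).mul continuous_const
  have hFint : ∀ k, ∫ s in 0..t, F k s = (1 - decay L k t) * c k := by
    intro k
    rw [hF]
    simp only
    rw [intervalIntegral.integral_mul_const, intervalIntegral.integral_const_mul, integral_decay]
  have hFnorm : ∀ k, ∫ s in Ioc 0 t, ‖F k s‖ = (1 - decay L k t) * |c k| := by
    intro k
    rw [← intervalIntegral.integral_of_le ht, ← integral_decay,
      ← intervalIntegral.integral_const_mul, ← intervalIntegral.integral_mul_const]
    refine intervalIntegral.integral_congr fun s _ => ?_
    simp only [hF, norm_mul, Real.norm_eq_abs, abs_pow, sq_abs, abs_of_pos (decay_pos L k s)]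
  have hsum := hasSum_integral_of_summable_integral_norm (μ := volume.restrict (Ioc 0 t)) (F := F)
    (fun k => ((hFc k).intervalIntegrable 0 t).1) <| by
      simp only [hFnorm]
      refine Summable.of_nonneg_of_le (fun k => ?_) (fun k => ?_) hcs
      · have : decay L k t ≤ 1 := by
          unfold decay
          rw [Real.exp_le_one_iff, neg_mul]
          exact neg_nonpos.2 (by positivity)
        have := abs_nonneg (c k)
        nlinarith
      · have := decay_pos L k t
        have := abs_nonneg (c k)
        nlinarith
  simp only [← intervalIntegral.integral_of_le ht, hFint] at hsum
  have hpt : ∫ s in 0..t, ∑' k, F k s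
      = ∫ s in 0..t, ⟪toL2 L (hφ.continuous_deriv le_rfl), heatDeriv L f s⟫ := by
    rw [intervalIntegral.integral_of_le ht, intervalIntegral.integral_of_le ht]
    refine setIntegral_congr_fun measurableSet_Ioc fun s hs => ?_
    refine HasSum.tsum_eq ?_
    refine ((hasSum_heatDeriv hL f hs.1).mapL
      (innerSL ℝ (toL2 L (hφ.continuous_deriv le_rfl)))).congr_fun fun k => ?_
    simp only [innerSL_apply_apply, inner_smul_right, cosMode, sinMode,
      inner_deriv_sinL2 hL.le _ hφ hφL, hF, hc]
    ring
  rw [← hpt]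
  have h1 := (hasSum_heat hL f ht).mapL (innerSL ℝ (toL2 L hφ.continuous))
  have h2 := (hasSum_heat hL f le_rfl).mapL (innerSL ℝ (toL2 L hφ.continuous))
  rw [heat_zero hL] at h2
  refine (h1.sub h2).unique (hsum.neg.congr_fun fun k => ?_)
  simp only [innerSL_apply_apply, inner_smul_right, hc, decay_zero]
  ring

/-- The pointwise bound 1/(2t) is not integrable at 0. Instead Parseval and Tonelli allow
integrating each mode in time first, which costs at most its squared initial coefficient. -/
theorem memLp_heatDeriv {L : ℝ} (hL : 0 < L) (f : L2 L) (T : ℝ) :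
    MemLp (heatDeriv L f) 2 (volume.restrict (Ioo 0 T)) := by
  rcases le_or_gt T 0 with hT | hT
  · simp [Ioo_eq_empty (not_lt.2 hT)]
  have hmeas : AEStronglyMeasurable (heatDeriv L f) (volume.restrict (Ioo 0 T)) := by
    refine aestronglyMeasurable_of_tendsto_ae atTop (f := fun n t => ∑ k ∈ Finset.range n,
      (-(freq L k * decay L k t * ⟪cosMode L k, f⟫)) • sinMode L k) (fun n => ?_) ?_
    · refine Continuous.aestronglyMeasurable (continuous_finsetSum _ fun k _ => ?_)
      have := continuous_decay L k
      fun_prop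
    · filter_upwards [ae_restrict_mem measurableSet_Ioo] with t ht
      exact (hasSum_heatDeriv hL f ht.1).tendsto_sum_nat
  refine ⟨hmeas, ?_⟩
  rw [eLpNorm_lt_top_iff_lintegral_rpow_enorm_lt_top two_ne_zero ENNReal.ofNat_ne_top]
  have e1 : ∫⁻ t in Ioo 0 T, ‖heatDeriv L f t‖ₑ ^ (2 : ENNReal).toReal
      = ∫⁻ t in Ioo 0 T, ∑' k, ENNReal.ofReal ((freq L k * decay L k t * ⟪cosMode L k, f⟫) ^ 2) := by
    refine setLIntegral_congr_fun measurableSet_Ioo fun t ht => ?_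
    have hs := hasSum_sq_heatDeriv hL f ht.1
    rw [← ENNReal.ofReal_tsum_of_nonneg (fun k => sq_nonneg _) hs.summable, hs.tsum_eq,
      ENNReal.ofReal_pow (norm_nonneg _), ofReal_norm]
    simp
  rw [e1, lintegral_tsum fun k => by
    have := continuous_decay L k
    exact (ENNReal.continuous_ofReal.comp (by fun_prop)).aemeasurable]
  have e2 : ∀ k, ∫⁻ t in Ioo 0 T, ENNReal.ofReal ((freq L k * decay L k t * ⟪cosMode L k, f⟫) ^ 2)
      ≤ ENNReal.ofReal (⟪cosMode L k, f⟫ ^ 2) := by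
    intro k
    have hcd := continuous_decay L k
    have hcont : Continuous fun t => (freq L k * decay L k t * ⟪cosMode L k, f⟫) ^ 2 := by fun_prop
    rw [← ofReal_integral_eq_lintegral_ofReal
      ((hcont.intervalIntegrable 0 T).1.mono_set Ioo_subset_Ioc_self)
      (ae_of_all _ fun t => sq_nonneg _), ← integral_Ioc_eq_integral_Ioo,
      ← intervalIntegral.integral_of_le hT.le]
    refine ENNReal.ofReal_le_ofReal ?_
    calc ∫ t in 0..T, (freq L k * decay L k t * ⟪cosMode L k, f⟫) ^ 2
        ≤ ∫ t in 0..T, freq L k ^ 2 * ⟪cosMode L k, f⟫ ^ 2 * decay L k t := by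
          refine intervalIntegral.integral_mono_on hT.le (hcont.intervalIntegrable _ _)
            (Continuous.intervalIntegrable (by fun_prop) _ _) fun t ht => ?_
          have h1 : decay L k t ≤ 1 := by
            unfold decay
            rw [Real.exp_le_one_iff, neg_mul]
            have := ht.1
            exact neg_nonpos.2 (by positivity)
          have h2 := decay_pos L k t
          -- This loses a factor 2 but lets `integral_decay` evaluate the bound.
          have h3 : decay L k t ^ 2 ≤ decay L k t := by nlinarith
          calc (freq L k * decay L k t * ⟪cosMode L k, f⟫) ^ 2
              = freq L k ^ 2 * ⟪cosMode L k, f⟫ ^ 2 * decay L k t ^ 2 := by ring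
            _ ≤ _ := by gcongr
      _ = (1 - decay L k T) * ⟪cosMode L k, f⟫ ^ 2 := by
          rw [intervalIntegral.integral_const_mul, ← integral_decay]; ring
      _ ≤ ⟪cosMode L k, f⟫ ^ 2 := by
          have := decay_pos L k T
          nlinarith [sq_nonneg ⟪cosMode L k, f⟫]
  refine (ENNReal.tsum_le_tsum e2).trans_lt ?_
  rw [← ENNReal.ofReal_tsum_of_nonneg (fun k => sq_nonneg _)
    (hasSum_inner_cosMode_sq hL f).summable]
  exact ENNReal.ofReal_lt_top

/-! ### Evolution equations on `[0, ∞)` -/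

theorem hasDerivWithinAt_integral_Ici {F : ℝ → ℝ} (hF : ContinuousOn F (Ici 0)) {t : ℝ}
    (ht : 0 ≤ t) : HasDerivWithinAt (fun t => ∫ s in 0..t, F s) (F t) (Ici 0) t := by
  -- The constant extension to negative times makes the two-sided fundamental theorem applicable at
  -- t = 0.
  set G : ℝ → ℝ := fun s => F (max s 0) with hG
  have hGc : Continuous G :=
    hF.comp_continuous (by fun_prop) fun s => le_max_right s 0
  have h := (intervalIntegral.integral_hasDerivAt_right (hGc.intervalIntegrable 0 t)
    (hGc.stronglyMeasurableAtFilter _ _) hGc.continuousAt).hasDerivWithinAt (s := Ici 0)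
  have hGF : ∀ s, 0 ≤ s → G s = F s := fun s hs => by rw [hG]; simp only [max_eq_left hs]
  rw [hGF t ht] at h
  refine h.congr_of_mem (fun x hx => ?_) ht
  refine intervalIntegral.integral_congr fun s hs => ?_
  rw [uIcc_of_le hx] at hs
  exact (hGF s hs.1).symm

theorem eq_exp_of_hasDerivWithinAt {p : ℝ → ℝ} {c : ℝ}
    (hp : ∀ t, 0 ≤ t → HasDerivWithinAt p (c * p t) (Ici 0) t) {t : ℝ} (ht : 0 ≤ t) :
    p t = p 0 * Real.exp (c * t) := by
  have hq : ∀ s, 0 ≤ s → HasDerivWithinAt (fun s => p s * Real.exp (-c * s)) 0 (Ici 0) s := by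
    intro s hs
    have he := ((hasDerivAt_id s).const_mul (-c)).exp.hasDerivWithinAt (s := Ici 0)
    refine ((hp s hs).mul he).congr_deriv ?_
    simp only [id]
    ring
  have h := constant_of_has_deriv_right_zero (a := 0) (b := t)
    (fun s hs => ((hq s hs.1).continuousWithinAt).mono Icc_subset_Ici_self)
    (fun s hs => (hq s hs.1).mono (Ici_subset_Ici.2 hs.1)) t ⟨ht, le_rfl⟩
  simp only [mul_zero, Real.exp_zero, mul_one, neg_mul] at h
  rw [← h, mul_assoc, ← Real.exp_add, neg_add_cancel, Real.exp_zero, mul_one]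

theorem continuousOn_integral_mul {L : ℝ} {u : ℝ → L2 L} {S : Set ℝ} (hu : ContinuousOn u S)
    {φ : ℝ → ℝ} (hφ : Continuous φ) : ContinuousOn (fun t => ∫ x in Ioo 0 L, u t x * φ x) S := by
  simp only [← inner_toL2 L hφ]
  exact continuousOn_const.inner hu

theorem hasDerivWithinAt_integral_mul {L : ℝ} {u : ℝ → L2 L} (hu : ContinuousOn u (Ici 0))
    {z : ℝ → ℝ} (hz : ContinuousOn z (Ici 0)) {φ χ : ℝ → ℝ} (hχ : Continuous χ) (a : ℝ)
    (h : ∀ t, 0 ≤ t → (∫ x in Ioo 0 L, u t x * φ x) - (∫ x in Ioo 0 L, u 0 x * φ x)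
      = ∫ s in (0 : ℝ)..t, ((∫ x in Ioo 0 L, u s x * χ x) - z s * a)) {t : ℝ} (ht : 0 ≤ t) :
    HasDerivWithinAt (fun t => ∫ x in Ioo 0 L, u t x * φ x)
      ((∫ x in Ioo 0 L, u t x * χ x) - z t * a) (Ici 0) t := by
  have hd := (hasDerivWithinAt_integral_Ici
    ((continuousOn_integral_mul hu hχ).sub (hz.mul (continuousOn_const (c := a)))) ht).add_const
    (∫ x in Ioo 0 L, u 0 x * φ x)
  refine hd.congr_of_mem (fun s hs => ?_) ht
  exact sub_eq_iff_eq_add.1 (h s hs)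

/-! ### The kernel `g` and the variable `Z` -/

theorem contDiff_g (L : ℝ) {n : WithTop ℕ∞} : ContDiff ℝ n (g L) := by
  unfold g; fun_prop

theorem deriv_g (L : ℝ) : deriv (g L) = fun x => -x := by
  funext x
  have : HasDerivAt (g L) (-x) x :=
    (((hasDerivAt_pow 2 x).const_sub (L ^ 2)).const_mul (1 / 2)).congr_deriv (by push_cast; ring)
  exact this.deriv

theorem deriv_deriv_g (L : ℝ) : deriv (deriv (g L)) = fun _ => -1 := by
  rw [deriv_g]
  funext x
  simp

theorem g_self (L : ℝ) : g L L = 0 := by simp [g]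

theorem Z_eq (L θ : ℝ) (u : L2 L) : Z L θ u = θ + ∫ x in Ioo 0 L, u x * g L x := by
  simp only [Z, mul_comm]

theorem Z_eq_inner (L θ : ℝ) (u : L2 L) :
    Z L θ u = θ + ⟪toL2 L (contDiff_g L (n := 1)).continuous, u⟫ := by
  rw [Z_eq, inner_toL2]

theorem continuousOn_Z {L : ℝ} {θ : ℝ → ℝ} {u : ℝ → L2 L} {S : Set ℝ} (hθ : ContinuousOn θ S)
    (hu : ContinuousOn u S) : ContinuousOn (fun t => Z L (θ t) (u t)) S := by
  simp only [Z_eq]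
  exact hθ.add (continuousOn_integral_mul hu (contDiff_g L (n := 1)).continuous)

/-! ### Uniqueness -/

namespace IsVeryWeakSolution

variable {L K θ₀ : ℝ} {u₀ : L2 L} {θ : ℝ → ℝ} {u : ℝ → L2 L}

theorem hasDerivWithinAt_integral (h : IsVeryWeakSolution L K θ₀ u₀ θ u) {φ : ℝ → ℝ}
    (hφ : ContDiff ℝ 2 φ) (hφ0 : deriv φ 0 = 0) (hφL : φ L = 0) {t : ℝ} (ht : 0 ≤ t) :
    HasDerivWithinAt (fun t => ∫ x in Ioo 0 L, u t x * φ x)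
      ((∫ x in Ioo 0 L, u t x * deriv (deriv φ) x) - K * Z L (θ t) (u t) * deriv φ L)
      (Ici 0) t := by
  have h2 : ContDiff ℝ (1 + 1) φ := by simpa [one_add_one_eq_two] using hφ
  exact hasDerivWithinAt_integral_mul h.continuousOn_snd
    (continuousOn_const.mul (continuousOn_Z h.continuousOn_fst h.continuousOn_snd))
    ((contDiff_succ_iff_deriv.1 h2).2.2.continuous_deriv le_rfl) _ (h.heat φ hφ hφ0 hφL) ht

/-- The heart of the matter: g'' = -1 cancels ϑ', and -g'(L) = L turns the boundary term into L K Z.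
-/
theorem Z_eq_exp (h : IsVeryWeakSolution L K θ₀ u₀ θ u) {t : ℝ} (ht : 0 ≤ t) :
    Z L (θ t) (u t) = Z L θ₀ u₀ * Real.exp (L * K * t) := by
  have hd : ∀ t, 0 ≤ t → HasDerivWithinAt (fun t => Z L (θ t) (u t))
      (L * K * Z L (θ t) (u t)) (Ici 0) t := by
    intro t ht
    have h1 := (h.ode t ht).add
      (h.hasDerivWithinAt_integral (contDiff_g L) (by simp [deriv_g]) (g_self L) ht)
    simp only [Z_eq L (θ _)]
    refine h1.congr_deriv ?_
    rw [deriv_deriv_g, deriv_g]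
    simp only [mul_neg, mul_one, integral_neg, Z_eq]
    ring
  rw [eq_exp_of_hasDerivWithinAt hd ht, h.init_fst, h.init_snd]

theorem unique (hL : 0 < L) (h : IsVeryWeakSolution L K θ₀ u₀ θ u) {θ' : ℝ → ℝ} {u' : ℝ → L2 L}
    (h' : IsVeryWeakSolution L K θ₀ u₀ θ' u') {t : ℝ} (ht : 0 ≤ t) :
    θ' t = θ t ∧ u' t = u t := by
  have hu : u' t = u t := by
    refine ext_inner_cosMode hL fun k => ?_
    rw [inner_cosMode, inner_cosMode]
    congr 1
    set φ : ℝ → ℝ := fun x => Real.cos (freq L k * x) with hφ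
    have hd1 : deriv φ = fun x => -freq L k * Real.sin (freq L k * x) := by
      funext x; exact (hasDerivAt_cos_mul _ x).deriv
    have hd2 : deriv (deriv φ) = fun x => -(freq L k ^ 2) * φ x := by
      rw [hd1]
      funext x
      rw [((hasDerivAt_sin_mul (freq L k) x).const_mul (-freq L k)).deriv]
      ring
    have hφ2 : ContDiff ℝ 2 φ := by fun_prop
    have hp : ∀ t, 0 ≤ t → HasDerivWithinAt
        (fun t => (∫ x in Ioo 0 L, u' t x * φ x) - ∫ x in Ioo 0 L, u t x * φ x)
        (-(freq L k ^ 2) * ((∫ x in Ioo 0 L, u' t x * φ x) - ∫ x in Ioo 0 L, u t x * φ x))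
        (Ici 0) t := by
      intro t ht
      have h0 : deriv φ 0 = 0 := by simp [hd1]
      refine ((h'.hasDerivWithinAt_integral hφ2 h0 (cos_freq_mul hL k) ht).sub
        (h.hasDerivWithinAt_integral hφ2 h0 (cos_freq_mul hL k) ht)).congr_deriv ?_
      -- Both boundary terms are the same explicit exponential, so they cancel in the difference.
      rw [h.Z_eq_exp ht, h'.Z_eq_exp ht, hd2]
      simp only [mul_left_comm _ (-(freq L k ^ 2)), integral_const_mul]
      ring
    have := eq_exp_of_hasDerivWithinAt hp ht
    rw [h.init_snd, h'.init_snd, sub_self, zero_mul] at this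
    exact sub_eq_zero.1 this
  refine ⟨?_, hu⟩
  have hZ := (h'.Z_eq_exp ht).trans (h.Z_eq_exp ht).symm
  rw [Z, Z, hu] at hZ
  exact add_right_cancel hZ

end IsVeryWeakSolution

/-! ### The solution of the closed loop -/

/-- The frequency `√(-L K)` of the part of the solution that is driven by the boundary input. -/
noncomputable def driveFreq (L K : ℝ) : ℝ := √(-(L * K))

theorem driveFreq_sq {L K : ℝ} (hL : 0 < L) (hK : K < 0) : driveFreq L K ^ 2 = -(L * K) :=
  Real.sq_sqrt (by nlinarith)

theorem cos_driveFreq_mul_ne_zero {L K : ℝ} (hL : 0 < L) (hK : K < 0)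
    (hK' : ∀ κ : ℕ, K ≠ -((2 * (κ : ℝ) + 1) ^ 2 * Real.pi ^ 2 / (4 * L ^ 3))) :
    Real.cos (driveFreq L K * L) ≠ 0 := by
  intro h
  obtain ⟨m, hm⟩ := Real.cos_eq_zero_iff.1 h
  have key : K = -((2 * (m : ℝ) + 1) ^ 2 * Real.pi ^ 2 / (4 * L ^ 3)) := by
    have h2 : (driveFreq L K * L) ^ 2 = -(L * K) * L ^ 2 := by rw [mul_pow, driveFreq_sq hL hK]
    rw [hm] at h2
    field_simp
    linear_combination 4 * h2
  rcases le_or_gt 0 m with h0 | h0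
  · obtain ⟨n, rfl⟩ := Int.eq_ofNat_of_zero_le h0
    exact hK' n (by simpa using key)
  -- The square (2m + 1)² is invariant under m ↦ -m - 1, which sends negative integers to naturals.
  · obtain ⟨n, hn⟩ := Int.eq_ofNat_of_zero_le (show 0 ≤ -m - 1 by omega)
    refine hK' n ?_
    have : (n : ℝ) = -m - 1 := by
      have : (n : ℤ) = -m - 1 := by simpa using hn.symm
      exact_mod_cast this
    rw [key, this]
    ring

/-- The amplitude at time `0` of the driven part `a e^{L K t} cos (√(-L K) x)`. -/
noncomputable def driveAmp (L K θ₀ : ℝ) (u₀ : L2 L) : ℝ :=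
  K * Z L θ₀ u₀ / Real.cos (driveFreq L K * L)

/-- The driven part of the solution, at time `0`. -/
noncomputable def drivePart (L K θ₀ : ℝ) (u₀ : L2 L) : L2 L :=
  driveAmp L K θ₀ u₀ • cosL2 L (driveFreq L K)

/-- The heat component of the solution. -/
noncomputable def solHeat (L K θ₀ : ℝ) (u₀ : L2 L) (t : ℝ) : L2 L :=
  heat L (u₀ - drivePart L K θ₀ u₀) t + Real.exp (L * K * t) • drivePart L K θ₀ u₀

/-- The space derivative of the heat component of the solution. -/
noncomputable def solHeatDeriv (L K θ₀ : ℝ) (u₀ : L2 L) (t : ℝ) : L2 L :=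
  heatDeriv L (u₀ - drivePart L K θ₀ u₀) t
    + Real.exp (L * K * t) •
      (-(driveAmp L K θ₀ u₀ * driveFreq L K)) • sinL2 L (driveFreq L K)

/-- The finite-dimensional component of the solution. -/
noncomputable def solState (L K θ₀ : ℝ) (u₀ : L2 L) (t : ℝ) : ℝ :=
  Z L θ₀ u₀ * Real.exp (L * K * t)
    - ⟪toL2 L (contDiff_g L (n := 1)).continuous, solHeat L K θ₀ u₀ t⟫

section Solution

variable {L K : ℝ} (θ₀ : ℝ) (u₀ : L2 L)

/-- `solState` is chosen to make this hold, which closes the loop; the price is that the equation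
for ϑ must be proved afterwards. -/
theorem Z_sol (t : ℝ) : Z L (solState L K θ₀ u₀ t) (solHeat L K θ₀ u₀ t)
    = Z L θ₀ u₀ * Real.exp (L * K * t) := by
  rw [Z_eq_inner, solState, sub_add_cancel]

theorem solHeat_zero (hL : 0 < L) : solHeat L K θ₀ u₀ 0 = u₀ := by
  simp [solHeat, heat_zero hL]

theorem solState_zero (hL : 0 < L) : solState L K θ₀ u₀ 0 = θ₀ := by
  simp [solState, solHeat_zero θ₀ u₀ hL, Z_eq_inner]

theorem continuousOn_solHeat (hL : 0 < L) : ContinuousOn (solHeat L K θ₀ u₀) (Ici 0) :=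
  (continuousOn_heat hL _).add (Continuous.continuousOn (by fun_prop))

theorem continuousOn_solState (hL : 0 < L) : ContinuousOn (solState L K θ₀ u₀) (Ici 0) :=
  (Continuous.continuousOn (by fun_prop)).sub
    (continuousOn_const.inner (continuousOn_solHeat θ₀ u₀ hL))

theorem memLp_solHeatDeriv (hL : 0 < L) (T : ℝ) :
    MemLp (solHeatDeriv L K θ₀ u₀) 2 (volume.restrict (Ioo 0 T)) :=
  (memLp_heatDeriv hL _ T).add
    ((ContinuousLinearMap.toSpanSingleton ℝ _).comp_memLp'
      (memLp_of_continuous T (by fun_prop : Continuous fun t => Real.exp (L * K * t))))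

theorem hasWeakDerivWithTrace_sol (hL : 0 < L) (hcos : Real.cos (driveFreq L K * L) ≠ 0) {t : ℝ}
    (ht : 0 < t) : HasWeakDerivWithTrace L (solHeat L K θ₀ u₀ t) (solHeatDeriv L K θ₀ u₀ t)
      (K * Z L (solState L K θ₀ u₀ t) (solHeat L K θ₀ u₀ t)) := by
  intro ψ hψ hψ0
  have h1 := hasWeakDerivWithTrace_heat hL (u₀ - drivePart L K θ₀ u₀) ht ψ hψ hψ0
  have h2 : driveAmp L K θ₀ u₀ * Real.cos (driveFreq L K * L) = K * Z L θ₀ u₀ := by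
    rw [driveAmp]; field_simp
  rw [← inner_toL2 L (hψ.continuous_deriv le_rfl), ← inner_toL2 L hψ.continuous] at h1 ⊢
  rw [Z_sol, solHeat, solHeatDeriv, drivePart]
  rw [drivePart] at h1
  simp only [inner_add_right, inner_smul_right, inner_deriv_cosL2 hL.le _ hψ hψ0]
  linear_combination h1 + Real.exp (L * K * t) * ψ L * h2

/-- For the driven part, ∂ₜ contributes L K and ∂ₓₓ contributes -`driveFreq`²; these agree by
`driveFreq_sq`. -/
theorem solHeat_weak_identity (hL : 0 < L) (hK : K < 0) {φ : ℝ → ℝ} (hφ : ContDiff ℝ 1 φ)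
    (hφL : φ L = 0) {t : ℝ} (ht : 0 ≤ t) :
    (∫ x in Ioo 0 L, solHeat L K θ₀ u₀ t x * φ x) - (∫ x in Ioo 0 L, solHeat L K θ₀ u₀ 0 x * φ x)
      = -∫ s in (0 : ℝ)..t, ∫ x in Ioo 0 L, solHeatDeriv L K θ₀ u₀ s x * deriv φ x := by
  have hd : Continuous (deriv φ) := hφ.continuous_deriv le_rfl
  have h1 := heat_weak_identity hL (u₀ - drivePart L K θ₀ u₀) hφ hφL ht
  have hint : IntervalIntegrable (fun s => ⟪toL2 L hd, heatDeriv L (u₀ - drivePart L K θ₀ u₀) s⟫)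
      volume 0 t := by
    rw [intervalIntegrable_iff_integrableOn_Ioo_of_le ht]
    exact ((memLp_heatDeriv hL (u₀ - drivePart L K θ₀ u₀) t).integrable one_le_two).const_inner _
  have hexp : L * K * ∫ s in (0 : ℝ)..t, Real.exp (L * K * s) = Real.exp (L * K * t) - 1 := by
    have hLK : L * K ≠ 0 := (mul_neg_of_pos_of_neg hL hK).ne
    rw [intervalIntegral.integral_comp_mul_left (fun x => Real.exp x) hLK, integral_exp,
      smul_eq_mul, mul_inv_cancel_left₀ hLK, mul_zero, Real.exp_zero]
  simp only [← inner_toL2 L hφ.continuous, ← inner_toL2 L hd]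
  simp only [solHeat, solHeatDeriv, inner_add_right, inner_smul_right]
  rw [intervalIntegral.integral_add hint (Continuous.intervalIntegrable (by fun_prop) _ _),
    intervalIntegral.integral_mul_const, heat_zero hL, inner_deriv_sinL2 hL.le _ hφ hφL]
  simp only [drivePart, inner_smul_right, mul_zero, Real.exp_zero] at h1 ⊢
  have hsq := driveFreq_sq hL hK
  linear_combination h1 - (driveAmp L K θ₀ u₀ * ⟪toL2 L hφ.continuous, cosL2 L (driveFreq L K)⟫)
      * hexp + (driveAmp L K θ₀ u₀ * ⟪toL2 L hφ.continuous, cosL2 L (driveFreq L K)⟫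
        * ∫ s in (0 : ℝ)..t, Real.exp (L * K * s)) * hsq

/-- The computation of `Z_eq_exp` read backwards: Z' = L K Z and (∫ g u)' = -∫ u + L K Z, so the
difference has derivative ∫ u. -/
theorem hasDerivWithinAt_solState (hL : 0 < L) (hK : K < 0)
    (hcos : Real.cos (driveFreq L K * L) ≠ 0) {t : ℝ} (ht : 0 ≤ t) :
    HasDerivWithinAt (solState L K θ₀ u₀) (∫ y in Ioo 0 L, solHeat L K θ₀ u₀ t y) (Ici 0) t := by
  have hz : Continuous fun t => K * (Z L θ₀ u₀ * Real.exp (L * K * t)) := by fun_prop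
  have h1 := hasDerivWithinAt_integral_mul (continuousOn_solHeat (K := K) θ₀ u₀ hL)
    hz.continuousOn (φ := g L) (continuous_const (y := (-1 : ℝ))) (-L) (fun t ht => by
      rw [solHeat_weak_identity θ₀ u₀ hL hK (contDiff_g L) (g_self L) ht,
        ← intervalIntegral.integral_neg, deriv_g]
      refine intervalIntegral.integral_congr_ae (ae_of_all _ fun s hs => ?_)
      rw [uIoc_of_le ht] at hs
      -- The trace identity tested with g' = -x performs the second integration by parts.
      have := hasWeakDerivWithTrace_sol θ₀ u₀ hL hcos hs.1 (fun x => -x) contDiff_neg neg_zero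
      simp only [deriv_neg', Z_sol] at this
      linarith) ht
  have he : HasDerivWithinAt (fun t => Z L θ₀ u₀ * Real.exp (L * K * t))
      (Z L θ₀ u₀ * (Real.exp (L * K * t) * (L * K))) (Ici 0) t := by
    have := ((hasDerivAt_id t).const_mul (L * K)).exp.const_mul (Z L θ₀ u₀)
    simpa using this.hasDerivWithinAt
  have h2 := he.sub h1
  have e : solState L K θ₀ u₀ = fun t => Z L θ₀ u₀ * Real.exp (L * K * t)
      - ∫ x in Ioo 0 L, solHeat L K θ₀ u₀ t x * g L x := by
    funext t
    rw [solState, inner_toL2]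
  rw [e]
  refine h2.congr_deriv ?_
  simp only [mul_neg, mul_one, integral_neg]
  ring

theorem isWeakSolution_sol (hL : 0 < L) (hK : K < 0)
    (hcos : Real.cos (driveFreq L K * L) ≠ 0) :
    IsWeakSolution L K θ₀ u₀ (solState L K θ₀ u₀) (solHeat L K θ₀ u₀) where
  continuousOn_fst := continuousOn_solState θ₀ u₀ hL
  continuousOn_snd := continuousOn_solHeat θ₀ u₀ hL
  init_fst := solState_zero θ₀ u₀ hL
  init_snd := solHeat_zero θ₀ u₀ hL
  ode := fun _ ht => hasDerivWithinAt_solState θ₀ u₀ hL hK hcos ht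
  heat := ⟨solHeatDeriv L K θ₀ u₀, memLp_solHeatDeriv θ₀ u₀ hL, by
    filter_upwards [ae_restrict_mem measurableSet_Ioi] with t ht
    exact hasWeakDerivWithTrace_sol θ₀ u₀ hL hcos ht,
    fun _ hφ hφL _ ht => solHeat_weak_identity θ₀ u₀ hL hK hφ hφL ht⟩

/-! ### Exponential decay -/

theorem Omega_eq (θ : ℝ) (u : L2 L) : Omega L θ u = θ ^ 2 + ‖u‖ ^ 2 := by
  rw [Omega, sq_abs, ← real_inner_self_eq_norm_sq, L2.inner_def]
  simp [sq]

theorem abs_Z_le (θ : ℝ) (u : L2 L) :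
    |Z L θ u| ≤ (1 + ‖toL2 L (contDiff_g L (n := 1)).continuous‖) * (|θ| + ‖u‖) := by
  rw [Z_eq_inner]
  have h := abs_real_inner_le_norm (toL2 L (contDiff_g L (n := 1)).continuous) u
  have h2 := abs_add_le θ ⟪toL2 L (contDiff_g L (n := 1)).continuous, u⟫
  have := norm_nonneg (toL2 L (contDiff_g L (n := 1)).continuous)
  have := norm_nonneg u
  have := mul_nonneg (norm_nonneg (toL2 L (contDiff_g L (n := 1)).continuous)) (abs_nonneg θ)
  linarith

theorem exists_norm_sol_le (hL : 0 < L) (hK : K < 0) :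
    ∃ C : ℝ, 0 < C ∧ ∃ r : ℝ, 0 < r ∧ ∀ (θ₀ : ℝ) (u₀ : L2 L) (t : ℝ), 0 ≤ t →
      ‖solHeat L K θ₀ u₀ t‖ ≤ C * (|θ₀| + ‖u₀‖) * Real.exp (-r * t) ∧
      |solState L K θ₀ u₀ t| ≤ C * (|θ₀| + ‖u₀‖) * Real.exp (-r * t) := by
  set G := ‖toL2 L (contDiff_g L (n := 1)).continuous‖ with hG
  have hG0 : 0 ≤ G := norm_nonneg _
  set B := |K / Real.cos (driveFreq L K * L)| * ‖cosL2 L (driveFreq L K)‖ with hB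
  have hB0 : 0 ≤ B := by positivity
  -- The driven part, of norm at most B (1 + G) N, enters twice: in the initial value of the heat
  -- flow and as a summand.
  set C := 1 + 2 * (B * (1 + G)) with hC
  have hC0 : 0 < C := by positivity
  -- The slower of the two rates: that of Z and that of the lowest mode.
  set r := min (-(L * K)) (freq L 0 ^ 2) with hr
  have hf := freq_pos hL 0
  have hr0 : 0 < r := lt_min (by nlinarith) (by positivity)
  refine ⟨(1 + G) * (C + 1), by positivity, r, hr0, fun θ₀ u₀ t ht => ?_⟩
  set N := |θ₀| + ‖u₀‖ with hN
  have hN0 : 0 ≤ N := by positivity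
  have hZ : |Z L θ₀ u₀| ≤ (1 + G) * N := abs_Z_le θ₀ u₀
  have hw : ‖drivePart L K θ₀ u₀‖ ≤ B * ((1 + G) * N) := by
    calc ‖drivePart L K θ₀ u₀‖ = B * |Z L θ₀ u₀| := by
          rw [drivePart, norm_smul, driveAmp, Real.norm_eq_abs, mul_div_right_comm, abs_mul, hB]
          ring
      _ ≤ _ := by gcongr
  have he1 : Real.exp (L * K * t) ≤ Real.exp (-r * t) := by
    have : L * K ≤ -r := by have := min_le_left (-(L * K)) (freq L 0 ^ 2); linarith
    gcongr
  have he2 : Real.exp (-(freq L 0 ^ 2) * t) ≤ Real.exp (-r * t) := by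
    have : r ≤ freq L 0 ^ 2 := min_le_right _ _
    gcongr
  have hu : ‖solHeat L K θ₀ u₀ t‖ ≤ C * N * Real.exp (-r * t) := by
    calc ‖solHeat L K θ₀ u₀ t‖
        ≤ ‖heat L (u₀ - drivePart L K θ₀ u₀) t‖
          + ‖Real.exp (L * K * t) • drivePart L K θ₀ u₀‖ := norm_add_le _ _
      _ ≤ Real.exp (-r * t) * (‖u₀‖ + ‖drivePart L K θ₀ u₀‖)
          + Real.exp (-r * t) * ‖drivePart L K θ₀ u₀‖ := by
          rw [norm_smul, Real.norm_eq_abs, Real.abs_exp]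
          refine add_le_add ((norm_heat_le hL _ ht).trans ?_) (by gcongr)
          gcongr
          exact norm_sub_le _ _
      _ = (‖u₀‖ + 2 * ‖drivePart L K θ₀ u₀‖) * Real.exp (-r * t) := by ring
      _ ≤ C * N * Real.exp (-r * t) := by
          gcongr
          have : ‖u₀‖ ≤ N := le_add_of_nonneg_left (abs_nonneg _)
          rw [hC]
          linarith
  have hθ : |solState L K θ₀ u₀ t| ≤ (1 + G) * (C + 1) * N * Real.exp (-r * t) := by
    calc |solState L K θ₀ u₀ t|
        ≤ |Z L θ₀ u₀ * Real.exp (L * K * t)|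
          + |⟪toL2 L (contDiff_g L (n := 1)).continuous, solHeat L K θ₀ u₀ t⟫| := abs_sub _ _
      _ ≤ (1 + G) * N * Real.exp (-r * t) + G * (C * N * Real.exp (-r * t)) := by
          rw [abs_mul, Real.abs_exp]
          refine add_le_add (by gcongr) ((abs_real_inner_le_norm _ _).trans (by gcongr))
      _ ≤ (1 + G) * (C + 1) * N * Real.exp (-r * t) := by
          have : 0 ≤ C * N * Real.exp (-r * t) := by positivity
          nlinarith
  refine ⟨hu.trans ?_, hθ⟩
  gcongr
  nlinarith [mul_nonneg hG0 hC0.le]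

theorem exists_Omega_sol_le (hL : 0 < L) (hK : K < 0) :
    ∃ η : ℝ, 0 < η ∧ ∃ ν : ℝ, 0 < ν ∧ ∀ (θ₀ : ℝ) (u₀ : L2 L) (t : ℝ), 0 ≤ t →
      Omega L (solState L K θ₀ u₀ t) (solHeat L K θ₀ u₀ t)
        ≤ η * Omega L (solState L K θ₀ u₀ 0) (solHeat L K θ₀ u₀ 0) * Real.exp (-ν * t) := by
  obtain ⟨C, hC, r, hr, h⟩ := exists_norm_sol_le hL hK
  -- One factor 2 counts the two components, the other comes from (a + b)² ≤ 2(a² + b²); squaring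
  -- doubles the rate.
  refine ⟨4 * C ^ 2, by positivity, 2 * r, by positivity, fun θ₀ u₀ t ht => ?_⟩
  obtain ⟨hu, hθ⟩ := h θ₀ u₀ t ht
  rw [solState_zero θ₀ u₀ hL, solHeat_zero θ₀ u₀ hL, Omega_eq, Omega_eq, ← sq_abs θ₀,
    ← sq_abs (solState L K θ₀ u₀ t)]
  have he : Real.exp (-(2 * r) * t) = Real.exp (-r * t) ^ 2 := by
    rw [← Real.exp_nat_mul]
    congr 1
    push_cast
    ring
  rw [he]
  calc |solState L K θ₀ u₀ t| ^ 2 + ‖solHeat L K θ₀ u₀ t‖ ^ 2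
      ≤ (C * (|θ₀| + ‖u₀‖) * Real.exp (-r * t)) ^ 2
        + (C * (|θ₀| + ‖u₀‖) * Real.exp (-r * t)) ^ 2 := by gcongr
    _ = 2 * C ^ 2 * (|θ₀| + ‖u₀‖) ^ 2 * Real.exp (-r * t) ^ 2 := by ring
    _ ≤ 2 * C ^ 2 * (2 * (|θ₀| ^ 2 + ‖u₀‖ ^ 2)) * Real.exp (-r * t) ^ 2 := by
        gcongr
        exact add_sq_le
    _ = _ := by ring

end Solution

end HeatCascade

theorem theorem1 (L K : ℝ) (hL : 0 < L) (hK : K < 0)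
    (hK' : ∀ κ : ℕ, K ≠ -((2 * (κ : ℝ) + 1) ^ 2 * Real.pi ^ 2 / (4 * L ^ 3))) :
    ∃ η : ℝ, 0 < η ∧ ∃ ν : ℝ, 0 < ν ∧
      ∀ (θ₀ : ℝ) (u₀ : HeatCascade.L2 L),
        ∃ (θ : ℝ → ℝ) (u : ℝ → HeatCascade.L2 L),
          HeatCascade.IsWeakSolution L K θ₀ u₀ θ u ∧
          (∀ (θ' : ℝ → ℝ) (u' : ℝ → HeatCascade.L2 L),
            HeatCascade.IsVeryWeakSolution L K θ₀ u₀ θ' u' →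
              ∀ t, 0 ≤ t → θ' t = θ t ∧ u' t = u t) ∧
          ∀ t, 0 ≤ t →
            HeatCascade.Omega L (θ t) (u t)
              ≤ η * HeatCascade.Omega L (θ 0) (u 0) * Real.exp (-ν * t) := by
  obtain ⟨η, hη, ν, hν, h⟩ := HeatCascade.exists_Omega_sol_le hL hK
  refine ⟨η, hη, ν, hν, fun θ₀ u₀ => ?_⟩
  have hsol := HeatCascade.isWeakSolution_sol θ₀ u₀ hL hK
    (HeatCascade.cos_driveFreq_mul_ne_zero hL hK hK')
  exact ⟨_, _, hsol, fun θ' u' h' t ht => hsol.isVeryWeakSolution.unique hL h' ht, h θ₀ u₀⟩
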